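/- Let $k$ be a commutative ring containing $\mathbb{Q}$, let $A$ be a commutative $k$-algebra with an augmentation $\varepsilon\colon A\to k$ (a $k$-algebra homomorphism), and let $I=\ker\varepsilon$, regarded as a non-unital $k$-algebra. Let $M$ be a symmetric $A$-bimodule which is flat over $k$. All tensor products are over $k$. For $B=A$ or $B=I$ let $C_\star(B,M)$ be the Hochschild complex: $C_n(B,M)=M\otimes B^{\otimes n}$, with boundary $b=\sum_{j=0}^{n}(-1)^j\partial_j$, where $\partial_0(m\otimes a_1\otimes\cdots\otimes a_n)=ma_1\otimes a_2\otimes\cdots\otimes a_n$, $\partial_j(m\otimes a_1\otimes\cdots\otimes a_n)=m\otimes a_1\otimes\cdots\otimes a_ja_{j+1}\otimes\cdots\otimes a_n$ for $1\le j\le n-1$, and $\partial_n(m\otimes a_1\otimes\cdots\otimes a_n)=a_nm\otimes a_1\otimes\cdots\otimes a_{n-1}$. Let $D_\star(A,M)\subseteq C_\star(A,M)$ be the degenerate subcomplex, generated in degree $n$ by the tensors $m\otimes a_1\otimes\cdots\otimes a_n$ with $a_j=1_A$ for at least one $j$. For $n\ge 1$ let $e_n^{(i)}\in\mathbb{Q}[\Sigma_n]$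 be the Eulerian idempotents, determined by $$\sum_{i} e_n^{(i)}X^i=\sum_{\sigma\in\Sigma_n}\operatorname{sgn}(\sigma)\binom{X-1-\operatorname{des}(\sigma)+n}{n}\,\sigma,$$ where $\operatorname{des}(\sigma)$ is the number of $j$ with $\sigma(j)>\sigma(j+1)$; so $e_n^{(i)}=0$ for $i>n$. They act on $M\otimes B^{\otimes n}$ through $\sigma(m\otimes a_1\otimes\cdots\otimes a_n)=m\otimes a_{\sigma^{-1}(1)}\otimes\cdots\otimes a_{\sigma^{-1}(n)}$. In degree $0$ fix any $w\in\mathbb{N}$ and put $e_0^{(w)}=1$ and $e_0^{(i)}=0$ for $i\ne w$ (the usual conventions are $w=0$ and $w=1$). Theorem. For each $i\ge 1$ the submodules $e_n^{(i)}C_n(A,M)$, $e_n^{(i)}C_n(I,M)$ and $e_n^{(i)}D_n(A,M)$ form subcomplexes $e_\star^{(i)}C_\star(A,M)$ and $e_\star^{(i)}D_\star(A,M)$ of $C_\star(A,M)$, and $e_\star^{(i)}C_\star(I,M)$ of $C_\star(I,M)$, and there is an isomorphism of chain complexes of $k$-modules $$e_\star^{(i)}C_\star(A,M)\cong e_\star^{(i)}C_\star(I,M)\oplus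 e_\star^{(i)}D_\star(A,M).$$ -/

import Mathlib

open CategoryTheory CategoryTheory.Limits
open scoped TensorProduct

/-! ### The Hochschild complex of a possibly non-unital algebra -/

namespace Hochschild

section Chains

universe u v w

variable (k : Type u) [CommRing k]

/-- `M ⊗ B^{⊗ n}`, tensor products over `k`. -/
abbrev Chains (B : Type v) [AddCommGroup B] [Module k B] (M : Type w) [AddCommGroup M] [Module k M]
    (n : ℕ) : Type (max u v w) :=
  M ⊗[k] (PiTensorProduct k fun _ : Fin n => B)

variable {k}

/-- The elementary tensor `m ⊗ a₁ ⊗ ⋯ ⊗ aₙ`. -/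
def elem (k : Type u) [CommRing k] {B : Type v} [AddCommGroup B] [Module k B]
    {M : Type w} [AddCommGroup M] [Module k M] {n : ℕ} (m : M) (a : Fin n → B) : Chains k B M n :=
  m ⊗ₜ[k] PiTensorProduct.tprod k a

end Chains

section Complex

set_option linter.unusedSectionVars false

universe u v v' w

variable {k : Type u} [CommRing k]
  {B : Type v'} [NonUnitalRing B] [Module k B] [IsScalarTower k B B] [SMulCommClass k B B]
  {A : Type v} [Ring A] [Algebra k A]

/-- The tensor factors (other than the coefficient) of the `i`-th face of
`m ⊗ a₁ ⊗ ⋯ ⊗ aₙ₊₁`; with the factors indexed from `0` this is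
`(a₁, …, aₙ)` for `i = 0`, `(a₀, …, aᵢ₋₁ aᵢ, …, aₙ)` for `1 ≤ i ≤ n` and
`(a₀, …, aₙ₋₁)` for `i = n + 1`. -/
def faceArgs {n : ℕ} (i : Fin (n + 2)) (a : Fin (n + 1) → B) (j : Fin n) : B :=
  if (j : ℕ) + 1 < i then a j.castSucc
  else if (j : ℕ) + 1 = i then a j.castSucc * a j.succ
  else a j.succ

variable (ι : B →ₙₐ[k] A)
  (M : Type w) [AddCommGroup M] [Module k M] [Module A M] [Module Aᵐᵒᵖ M]
  [IsScalarTower k A M] [IsScalarTower k Aᵐᵒᵖ M]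

/-- The effect of the `i`-th face on the coefficient: `m ↦ m a₁` for `i = 0`, `m ↦ aₙ₊₁ m` for
`i = n + 1`, and `m ↦ m` otherwise. Elements of `B` act on `M` through `ι`. -/
def faceCoeff {n : ℕ} (i : Fin (n + 2)) (a : Fin (n + 1) → B) : M →ₗ[k] M :=
  if i = 0 then Algebra.lsmul k k M (MulOpposite.op (ι (a 0)))
  else if i = Fin.last (n + 1) then Algebra.lsmul k k M (ι (a (Fin.last n)))
  else LinearMap.id

theorem faceArgs_update_zero {n : ℕ} [DecidableEq (Fin (n + 1))] (a : Fin (n + 1) → B) (x : B) :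
    faceArgs 0 (Function.update a 0 x) = faceArgs 0 a := by
  funext j
  simp [faceArgs]

theorem faceArgs_update_last {n : ℕ} [DecidableEq (Fin (n + 1))] (a : Fin (n + 1) → B) (x : B) :
    faceArgs (Fin.last (n + 1)) (Function.update a (Fin.last n) x) =
      faceArgs (Fin.last (n + 1)) a := by
  funext j
  simp [faceArgs]

/-- Away from the two exceptional cases, updating one factor updates one factor of the face. -/
theorem faceArgs_update {n : ℕ} [DecidableEq (Fin (n + 1))] [DecidableEq (Fin n)] (i : Fin (n + 2))
    (a : Fin (n + 1) → B) (p : Fin (n + 1)) (h0 : ¬(i = 0 ∧ p = 0))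
    (hl : ¬(i = Fin.last (n + 1) ∧ p = Fin.last n)) :
    ∃ (q : Fin n) (L : B →ₗ[k] B), ∀ x,
      faceArgs i (Function.update a p x) = Function.update (faceArgs i a) q (L x) := by
  obtain ⟨i, hi⟩ := i
  obtain ⟨p, hp⟩ := p
  simp only [Fin.ext_iff, Fin.val_zero, Fin.val_last] at h0 hl
  rcases lt_trichotomy (p + 1) i with h | h | h
  · refine ⟨⟨p, by omega⟩, LinearMap.id, fun x => funext fun j => ?_⟩
    obtain ⟨j, hj⟩ := j
    simp only [faceArgs, Function.update_apply, Fin.ext_iff, Fin.val_castSucc, Fin.val_succ,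
      LinearMap.id_apply]
    grind
  · refine ⟨⟨p, by omega⟩, LinearMap.mulRight k (a ⟨p + 1, by omega⟩), fun x => funext fun j => ?_⟩
    obtain ⟨j, hj⟩ := j
    simp only [faceArgs, Function.update_apply, Fin.ext_iff, Fin.val_castSucc, Fin.val_succ,
      LinearMap.mulRight_apply]
    by_cases hjp : j = p
    · subst hjp
      subst h
      simp
    · grind
  · by_cases hpi : p = i
    · subst hpi
      refine ⟨⟨p - 1, by omega⟩, LinearMap.mulLeft k (a ⟨p - 1, by omega⟩),
        fun x => funext fun j => ?_⟩
      obtain ⟨j, hj⟩ := j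
      simp only [faceArgs, Function.update_apply, Fin.ext_iff, Fin.val_castSucc, Fin.val_succ,
        LinearMap.mulLeft_apply]
      by_cases hjp : j + 1 = p
      · subst hjp
        simp
      · grind
    · refine ⟨⟨p - 1, by omega⟩, LinearMap.id, fun x => funext fun j => ?_⟩
      obtain ⟨j, hj⟩ := j
      simp only [faceArgs, Function.update_apply, Fin.ext_iff, Fin.val_castSucc, Fin.val_succ,
        LinearMap.id_apply]
      grind

theorem faceCoeff_update {n : ℕ} [DecidableEq (Fin (n + 1))] (i : Fin (n + 2))
    (a : Fin (n + 1) → B) (p : Fin (n + 1)) (h0 : ¬(i = 0 ∧ p = 0))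
    (hl : ¬(i = Fin.last (n + 1) ∧ p = Fin.last n)) (x : B) :
    faceCoeff ι M i (Function.update a p x) = faceCoeff ι M i a := by
  unfold faceCoeff
  split_ifs with h1 h2
  · rw [Function.update_of_ne (fun h => h0 ⟨h1, h.symm⟩)]
  · rw [Function.update_of_ne (fun h => hl ⟨h2, h.symm⟩)]
  · rfl

/-- The `i`-th face as a multilinear function of the tensor factors. -/
def faceMultilinear {n : ℕ} (i : Fin (n + 2)) :
    MultilinearMap k (fun _ : Fin (n + 1) => B) (M →ₗ[k] Chains k B M n) where
  toFun a := (TensorProduct.mk k M (PiTensorProduct k fun _ : Fin n => B)).flip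
    (PiTensorProduct.tprod k (faceArgs i a)) ∘ₗ faceCoeff ι M i a
  map_update_add' a p x y := by
    by_cases h0 : i = 0 ∧ p = 0
    · obtain ⟨rfl, rfl⟩ := h0
      ext m
      simp [faceArgs_update_zero, faceCoeff]
    by_cases hl : i = Fin.last (n + 1) ∧ p = Fin.last n
    · obtain ⟨rfl, rfl⟩ := hl
      ext m
      simp [faceArgs_update_last, faceCoeff]
    obtain ⟨q, L, hL⟩ := faceArgs_update (k := k) i a p h0 hl
    simp only [faceCoeff_update ι M i a p h0 hl, hL, map_add, MultilinearMap.map_update_add,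
      LinearMap.add_comp]
  map_update_smul' a p c x := by
    by_cases h0 : i = 0 ∧ p = 0
    · obtain ⟨rfl, rfl⟩ := h0
      ext m
      simp [faceArgs_update_zero, faceCoeff, TensorProduct.smul_tmul']
    by_cases hl : i = Fin.last (n + 1) ∧ p = Fin.last n
    · obtain ⟨rfl, rfl⟩ := hl
      ext m
      simp [faceArgs_update_last, faceCoeff, TensorProduct.smul_tmul']
    obtain ⟨q, L, hL⟩ := faceArgs_update (k := k) i a p h0 hl
    simp only [faceCoeff_update ι M i a p h0 hl, hL, map_smul, MultilinearMap.map_update_smul,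
      LinearMap.smul_comp]

/-- The `i`-th face map `M ⊗ B^{⊗ (n+1)} → M ⊗ B^{⊗ n}`. -/
def face {n : ℕ} (i : Fin (n + 2)) : Chains k B M (n + 1) →ₗ[k] Chains k B M n :=
  TensorProduct.lift (PiTensorProduct.lift (faceMultilinear ι M i)).flip

theorem face_elem {n : ℕ} (i : Fin (n + 2)) (m : M) (a : Fin (n + 1) → B) :
    face ι M i (elem k m a) = elem k (faceCoeff ι M i a m) (faceArgs i a) := by
  simp [face, elem, faceMultilinear]

/-- The Hochschild boundary `b`, the alternating sum of the faces. -/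
def boundary (n : ℕ) : Chains k B M (n + 1) →ₗ[k] Chains k B M n :=
  ∑ i : Fin (n + 2), (-1 : ℤ) ^ (i : ℕ) • face ι M i

theorem chains_hom_ext {N : Type*} [AddCommGroup N] [Module k N] {n : ℕ}
    {f g : Chains k B M n →ₗ[k] N} (h : ∀ m a, f (elem k m a) = g (elem k m a)) : f = g := by
  ext m a
  exact h m a

theorem faceArgs_faceArgs {n : ℕ} (i j : Fin (n + 2)) (hij : i ≤ j) (a : Fin (n + 2) → B) :
    faceArgs i (faceArgs j.succ a) = faceArgs j (faceArgs i.castSucc a) := by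
  obtain ⟨i, hi⟩ := i
  obtain ⟨j, hj⟩ := j
  funext ⟨l, hl⟩
  simp only [Fin.mk_le_mk] at hij
  simp only [faceArgs, Fin.castSucc_mk, Fin.succ_mk]
  split_ifs <;> first | rfl | omega | simp only [mul_assoc]

theorem faceCoeff_faceCoeff [SMulCommClass A Aᵐᵒᵖ M] {n : ℕ} (i j : Fin (n + 2)) (hij : i ≤ j)
    (a : Fin (n + 2) → B) (m : M) :
    faceCoeff ι M i (faceArgs j.succ a) (faceCoeff ι M j.succ a m) =
      faceCoeff ι M j (faceArgs i.castSucc a) (faceCoeff ι M i.castSucc a m) := by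
  obtain ⟨i, hi⟩ := i
  obtain ⟨j, hj⟩ := j
  simp only [Fin.mk_le_mk] at hij
  have hlr : ∀ x y : A, MulOpposite.op x • y • m = y • MulOpposite.op x • m :=
    fun x y => (smul_comm y (MulOpposite.op x) m).symm
  simp only [faceCoeff, faceArgs, Fin.ext_iff, Fin.castSucc_mk, Fin.succ_mk, Fin.val_zero,
    Fin.val_last, Fin.castSucc_zero, Fin.succ_zero_eq_one, Fin.succ_last]
  by_cases hi0 : i = 0
  · subst hi0
    by_cases hj0 : j = 0
    · subst hj0
      simp
    · by_cases hjn : j = n + 1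
      · subst hjn
        simp [hlr]
      · have h1 : ¬ (j + 1 = n + 2) := by omega
        have h2 : 0 < j := by omega
        simp [hj0, hjn, h2]
  · have hj0 : j ≠ 0 := by omega
    have hin : i ≠ n + 2 := by omega
    by_cases hjn : j = n + 1
    · subst hjn
      by_cases hi1 : i = n + 1
      · subst hi1
        simp
      · have h2 : ¬ (n + 1 < i) := by omega
        have h3 : ¬ (n + 1 = i) := by omega
        simp [hi0, hi1, hin, h2, h3]
    · have hi1 : i ≠ n + 1 := by omega
      simp [hi0, hj0, hjn, hi1, hin]

theorem boundary_comp_boundary [SMulCommClass A Aᵐᵒᵖ M] (n : ℕ) :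
    (boundary ι M n : Chains k B M (n + 1) →ₗ[k] _) ∘ₗ boundary ι M (n + 1) = 0 := by
  have key : ∀ i j : Fin (n + 2), i ≤ j →
      face ι M i ∘ₗ face ι M j.succ = face ι M j ∘ₗ face (k := k) ι M i.castSucc := by
    intro i j hij
    refine chains_hom_ext M fun m a => ?_
    simp only [LinearMap.comp_apply, face_elem, faceCoeff_faceCoeff ι M i j hij,
      faceArgs_faceArgs i j hij]
  have expand : (boundary ι M n : Chains k B M (n + 1) →ₗ[k] _) ∘ₗ boundary ι M (n + 1) =
      ∑ i : Fin (n + 2), ∑ j : Fin (n + 3),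
        ((-1 : ℤ) ^ (i : ℕ) • face ι M i) ∘ₗ ((-1 : ℤ) ^ (j : ℕ) • face ι M j) := by
    refine LinearMap.ext fun x => ?_
    simp only [boundary, LinearMap.sum_apply, LinearMap.comp_apply, map_sum]
    exact Finset.sum_comm
  rw [expand, ← Finset.sum_product']
  let P := Fin (n + 2) × Fin (n + 3)
  let S : Finset P := {ij : P | (ij.2 : ℕ) ≤ (ij.1 : ℕ)}
  rw [Finset.univ_product_univ, ← Finset.sum_add_sum_compl S, ← eq_neg_iff_add_eq_zero,
    ← Finset.sum_neg_distrib]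
  let φ : ∀ ij : P, ij ∈ S → P := fun ij hij =>
    (Fin.castLT ij.2 (lt_of_le_of_lt (Finset.mem_filter.mp hij).right (Fin.is_lt ij.1)), ij.1.succ)
  apply Finset.sum_bij φ
  · intro ij hij
    simp_rw [S, φ, Finset.compl_filter, Finset.mem_filter_univ, Fin.val_succ,
      Fin.val_castLT] at hij ⊢
    lia
  · rintro ⟨i, j⟩ hij ⟨i', j'⟩ hij' h
    rw [Prod.mk_inj]
    exact ⟨by simpa [φ] using! congr_arg Prod.snd h,
      by simpa [φ, Fin.castSucc_castLT] using! congr_arg Fin.castSucc (congr_arg Prod.fst h)⟩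
  · rintro ⟨i', j'⟩ hij'
    simp_rw [S, Finset.compl_filter, Finset.mem_filter_univ, not_le] at hij'
    refine ⟨(j'.pred <| ?_, Fin.castSucc i'), ?_, ?_⟩
    · rintro rfl
      simp only [Fin.val_zero, not_lt_zero] at hij'
    · simpa [S] using! Nat.le_sub_one_of_lt hij'
    · simp only [φ, Fin.castLT_castSucc, Fin.succ_pred]
  · rintro ⟨i, j⟩ hij
    have hij' : (j : ℕ) ≤ i := by simpa [S] using! hij
    dsimp only
    rw [LinearMap.smul_comp, LinearMap.comp_smul, LinearMap.smul_comp, LinearMap.comp_smul,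
      smul_smul, smul_smul, ← neg_smul]
    congr 1
    · simp only [φ, Fin.val_succ, Fin.val_castLT, pow_add, pow_one, mul_neg, neg_neg, mul_one]
      apply mul_comm
    · simp only [φ]
      rw [key _ _ (by simpa [Fin.le_def] using hij'), Fin.castSucc_castLT]

/-- The Hochschild complex `C_⋆(B, M)`: the module `M ⊗ B^{⊗ n}` in degree `n`, with boundary `b`.
The algebra `B` need not be unital; `M` is an `A`-bimodule, seen as a `B`-bimodule via `ι`. -/
noncomputable def complex [SMulCommClass A Aᵐᵒᵖ M] : ChainComplex (ModuleCat k) ℕ :=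
  ChainComplex.of (fun n => ModuleCat.of k (Chains k B M n))
    (fun n => ModuleCat.ofHom (boundary ι M n))
    (fun n => by rw [← ModuleCat.ofHom_comp, boundary_comp_boundary]; rfl)

end Complex

/-- The degree `n` part of the degenerate subcomplex `D_⋆(A, M)` of `C_⋆(A, M)`: the submodule
generated by the elementary tensors with at least one factor (other than the coefficient)
equal to `1`. -/
def degenerate (k A M : Type*) [CommRing k] [Ring A] [Algebra k A] [AddCommGroup M] [Module k M]
    (n : ℕ) : Submodule k (Chains k A M n) :=
  Submodule.span k {x | ∃ (m : M) (a : Fin n → A), (∃ j, a j = 1) ∧ x = elem k m a}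

end Hochschild

/-! ### Eulerian idempotents -/

namespace Eulerian

open Polynomial in
/-- The polynomial `(X - d)(X - d + 1) ⋯ (X - d + n - 1) / n!`, that is, the binomial coefficient
`X - 1 - d + n` over `n`. -/
noncomputable def poly (n d : ℕ) : ℚ[X] :=
  C ((n.factorial : ℚ)⁻¹) * ∏ s ∈ Finset.range n, (X - C (d : ℚ) + C (s : ℚ))

/-- The number of descents of `σ`: positions `j` with `σ (j + 1) < σ j`. -/
def descents : {n : ℕ} → Equiv.Perm (Fin n) → ℕ
  | 0, _ => 0
  | n + 1, σ => (Finset.univ.filter fun j : Fin n => σ j.succ < σ j.castSucc).card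

/-- The Eulerian idempotent `e_n^{(i)} ∈ ℚ[Σ_n]`. For `n ≥ 1` these are determined by
`∑ i, e_n^{(i)} X ^ i = ∑ σ, sgn σ * binom (X - 1 - des σ + n) n * σ`.
In degree `n = 0` there is a single nonzero idempotent, the identity, which is placed in
weight `w`. -/
noncomputable def idempotent (w : ℕ) : (n i : ℕ) → MonoidAlgebra ℚ (Equiv.Perm (Fin n))
  | 0, i => if i = w then 1 else 0
  | n + 1, i => ∑ σ : Equiv.Perm (Fin (n + 1)),
      MonoidAlgebra.single σ
        (((Equiv.Perm.sign σ : ℤ) : ℚ) * (poly (n + 1) (descents σ)).coeff i)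

/-- The action of `ℚ[Σ_n]` on `M ⊗ B^{⊗ n}`, with
`σ (m ⊗ b₁ ⊗ ⋯ ⊗ bₙ) = m ⊗ b_{σ⁻¹(1)} ⊗ ⋯ ⊗ b_{σ⁻¹(n)}`. -/
noncomputable def action {k B M : Type*} [CommRing k] [Algebra ℚ k] [AddCommGroup B] [Module k B]
    [AddCommGroup M] [Module k M] {n : ℕ} (e : MonoidAlgebra ℚ (Equiv.Perm (Fin n))) :
    Hochschild.Chains k B M n →ₗ[k] Hochschild.Chains k B M n :=
  ∑ σ : Equiv.Perm (Fin n), algebraMap ℚ k (e.coeff σ) •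
    LinearMap.lTensor M (PiTensorProduct.reindex k (fun _ : Fin n => B) σ).toLinearMap

/-- The image `e_n^{(i)} S` of a submodule `S` of `M ⊗ B^{⊗ n}`. -/
noncomputable def part {k B M : Type*} [CommRing k] [Algebra ℚ k] [AddCommGroup B] [Module k B]
    [AddCommGroup M] [Module k M] (w i n : ℕ) (S : Submodule k (Hochschild.Chains k B M n)) :
    Submodule k (Hochschild.Chains k B M n) :=
  S.map (action (idempotent w n i))

end Eulerian

/-! ### Subcomplexes and the augmentation ideal -/

/-- A family of submodules is a subcomplex if it is stable under the boundary. -/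
def IsSubcomplex {k : Type*} [CommRing k] (K : ChainComplex (ModuleCat k) ℕ)
    (S : ∀ n, Submodule k (K.X n)) : Prop :=
  ∀ i j : ℕ, ∀ x ∈ S i, (K.d i j).hom x ∈ S j

/-- A subcomplex, as a chain complex with the restricted boundary. -/
noncomputable def IsSubcomplex.complex {k : Type*} [CommRing k] {K : ChainComplex (ModuleCat k) ℕ}
    {S : ∀ n, Submodule k (K.X n)} (h : IsSubcomplex K S) : ChainComplex (ModuleCat k) ℕ where
  X n := ModuleCat.of k (S n)
  d i j := ModuleCat.ofHom ((K.d i j).hom.restrict (h i j))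
  shape i j hij := by
    ext x
    have := congrArg (fun f : K.X i ⟶ K.X j => f.hom (x : K.X i)) (K.shape i j hij)
    exact this
  d_comp_d' i j l _ _ := by
    ext x
    have := congrArg (fun f : K.X i ⟶ K.X l => f.hom (x : K.X i)) (K.d_comp_d i j l)
    exact this

/-- The augmentation ideal `I = Ker ε`, as a non-unital algebra. -/
def augmentationIdeal {k A : Type*} [CommRing k] [Ring A] [Algebra k A] (ε : A →ₐ[k] k) :
    NonUnitalSubalgebra k A where
  carrier := {a | ε a = 0}
  zero_mem' := map_zero ε
  add_mem' {a b} ha hb := by simp_all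
  mul_mem' {a b} ha hb := by simp_all
  smul_mem' c a ha := by simp_all

namespace Hochschild

universe u v w

variable {k : Type u} [CommRing k] {A : Type v} [Ring A] [Algebra k A]
  (M : Type w) [AddCommGroup M] [Module k M] [Module A M] [Module Aᵐᵒᵖ M]
  [IsScalarTower k A M] [IsScalarTower k Aᵐᵒᵖ M] [SMulCommClass A Aᵐᵒᵖ M]

variable (k A) in
/-- The Hochschild complex `C_⋆(A, M)` of an algebra `A` with coefficients in a bimodule `M`. -/
noncomputable abbrev algebraComplex : ChainComplex (ModuleCat.{max u v w} k) ℕ :=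
  complex (NonUnitalAlgHom.id k A) M

/-- The complex `C_⋆(I, M)` of the augmentation ideal `I` of `ε`. -/
noncomputable abbrev idealComplex (ε : A →ₐ[k] k) : ChainComplex (ModuleCat.{max u v w} k) ℕ :=
  complex (NonUnitalSubalgebraClass.subtype (augmentationIdeal ε)) M

end Hochschild

/-! The augmentation splits A as k·1 ⊕ I. Write each factor as a = ε(a)·1 + (a − ε(a)·1) and expand
an elementary tensor: the one summand using no scalar part comes from M ⊗ I^{⊗n}, all others are
degenerate. Hence C_n(A,M) = C_n(I,M) ⊕ D_n(A,M) (`sub_chainsMap_mem_degenerate`,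
`chainsMap_proj_eq_zero`). The inclusion J of C(I,M) commutes with b because I → A is
multiplicative. The projection P comes from a map that need not be multiplicative, but it is a chain
map because D is a subcomplex killed by P (`chainsMap_proj_boundary`). J and P treat all tensor
slots alike, so they commute with Σ_n and the splitting restricts to the images of e_n^{(i)}.

What remains is b e_{n+1}^{(i)} = e_n^{(i)} b for commutative B and symmetric M (`boundary_action`).
The coefficient of σ in e_n^{(i)} is sgn σ times a function of des σ. Expand b(σx) into faces. A
face multiplying two factors that were not neighbours in x cancels against the permutation with
these two exchanged. A product of former neighbours occurs twice, with opposite signs and descent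
numbers d and d + 1, and the Pascal rule `poly_sub_poly` turns the difference into a coefficient one
degree lower. Of the outer faces, absorbing an interior factor of x from one side cancels absorbing
it from the other, while the first and last factors again leave Pascal differences. -/

/-! ### Inserting a value into a permutation -/

namespace Eulerian

open Equiv

/-- The permutation sending `p` to `v` and inducing `τ` between the complements of `p` and `v`. -/
def insertPerm {n : ℕ} (p v : Fin (n + 1)) (τ : Perm (Fin n)) : Perm (Fin (n + 1)) :=
  v.cycleRange.symm * Perm.decomposeFin.symm (0, τ) * p.cycleRange

@[simp]
theorem insertPerm_self {n : ℕ} (p v : Fin (n + 1)) (τ : Perm (Fin n)) :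
    insertPerm p v τ p = v := by
  simp [insertPerm]

@[simp]
theorem insertPerm_succAbove {n : ℕ} (p v : Fin (n + 1)) (τ : Perm (Fin n)) (l : Fin n) :
    insertPerm p v τ (p.succAbove l) = v.succAbove (τ l) := by
  simp [insertPerm]

theorem sign_insertPerm {n : ℕ} (p v : Fin (n + 1)) (τ : Perm (Fin n)) :
    ((Perm.sign (insertPerm p v τ) : ℤ)) = (-1) ^ ((p : ℕ) + v) * (Perm.sign τ : ℤ) := by
  simp only [insertPerm, Perm.sign_mul, Perm.sign_symm, Fin.sign_cycleRange,
    Perm.decomposeFin.symm_sign]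
  push_cast
  ring

theorem insertPerm_injective {n : ℕ} (v : Fin (n + 1)) :
    Function.Injective fun x : Fin (n + 1) × Perm (Fin n) => insertPerm x.1 v x.2 := by
  rintro ⟨p, τ⟩ ⟨p', τ'⟩ h
  dsimp only at h
  obtain rfl : p = p' := (insertPerm p v τ).injective (by rw [insertPerm_self, h, insertPerm_self])
  refine Prod.ext rfl (Equiv.ext fun l => Fin.succAbove_right_injective (p := v) ?_)
  rw [← insertPerm_succAbove p, ← insertPerm_succAbove p, h]

/-- Both sides have (n + 1)! elements, so injectivity suffices. Sums over permutations can thus be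
organised by the position `p` at which a fixed value `v` is taken. -/
theorem insertPerm_bijective {n : ℕ} (v : Fin (n + 1)) :
    Function.Bijective fun x : Fin (n + 1) × Perm (Fin n) => insertPerm x.1 v x.2 := by
  rw [Fintype.bijective_iff_injective_and_card]
  refine ⟨insertPerm_injective v, ?_⟩
  simp [Fintype.card_perm, Nat.factorial_succ]

theorem exists_eq_insertPerm {n : ℕ} (σ : Perm (Fin (n + 1))) {p v : Fin (n + 1)} (h : σ p = v) :
    ∃ τ, σ = insertPerm p v τ := by
  obtain ⟨⟨p', τ⟩, rfl⟩ := (insertPerm_bijective v).surjective σ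
  obtain rfl : p = p' := (insertPerm p' v τ).injective (by rw [insertPerm_self]; exact h)
  exact ⟨τ, rfl⟩

theorem insertPerm_succ_castSucc {n : ℕ} (j : Fin n) (v : Fin (n + 1)) (τ : Perm (Fin n)) :
    insertPerm j.succ v τ j.castSucc = v.succAbove (τ j) := by
  rw [← insertPerm_succAbove j.succ, Fin.succAbove_succ_self]

/-! ### Descents of an insertion -/

theorem descents_eq_sum {n : ℕ} (σ : Perm (Fin (n + 1))) :
    descents σ = ∑ j : Fin n, if σ j.succ < σ j.castSucc then 1 else 0 := by
  rw [descents, Finset.card_filter]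

theorem descents_insertPerm_zero {n : ℕ} (v : Fin (n + 2)) (τ : Perm (Fin (n + 1))) :
    descents (insertPerm 0 v τ) = (if v.succAbove (τ 0) < v then 1 else 0) + descents τ := by
  have h (l : Fin (n + 1)) : insertPerm 0 v τ l.succ = v.succAbove (τ l) := by
    rw [← insertPerm_succAbove 0, Fin.zero_succAbove]
  rw [descents_eq_sum, descents_eq_sum, Fin.sum_univ_succ]
  simp only [h, Fin.castSucc_zero, insertPerm_self, Fin.castSucc_succ,
    Fin.succAbove_lt_succAbove_iff]

theorem descents_insertPerm_last {n : ℕ} (v : Fin (n + 2)) (τ : Perm (Fin (n + 1))) :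
    descents (insertPerm (Fin.last _) v τ) =
      descents τ + if v < v.succAbove (τ (Fin.last n)) then 1 else 0 := by
  have h (l : Fin (n + 1)) : insertPerm (Fin.last _) v τ l.castSucc = v.succAbove (τ l) := by
    rw [← insertPerm_succAbove (Fin.last _), Fin.succAbove_last]
  rw [descents_eq_sum, descents_eq_sum, Fin.sum_univ_castSucc]
  simp only [h, Fin.succ_last, insertPerm_self, Fin.succ_castSucc,
    Fin.succAbove_lt_succAbove_iff]

/-- No other value lies between `v` and its neighbour `τ j`, so the entry after the insertion
compares with `v` as it did with `τ j`. Only the comparison of `τ j` with `v` is new. -/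
theorem descents_insertPerm_adjacent {n : ℕ} (j : Fin (n + 1)) (v : Fin (n + 2))
    (τ : Perm (Fin (n + 1))) (hv : v = (τ j).succ ∨ v = (τ j).castSucc) :
    descents (insertPerm j.succ v τ) = (if v < v.succAbove (τ j) then 1 else 0) + descents τ := by
  rw [descents_eq_sum, descents_eq_sum, Fin.sum_univ_succAbove _ j]
  congr 1
  · rw [insertPerm_self, insertPerm_succ_castSucc]
  refine Finset.sum_congr rfl fun l _ => if_congr ?_ rfl rfl
  rcases lt_or_ge l.castSucc j with hl | hl
  · have h1 : (j.succAbove l).succ = j.succ.succAbove l.succ := by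
      rw [Fin.succ_succAbove_succ]
    have h2 : (j.succAbove l).castSucc = j.succ.succAbove l.castSucc := by
      rw [Fin.succAbove_of_castSucc_lt _ _ hl, Fin.succAbove_of_castSucc_lt]
      exact Fin.castSucc_lt_succ_iff.2 hl.le
    rw [h1, h2, insertPerm_succAbove, insertPerm_succAbove, Fin.succAbove_lt_succAbove_iff]
  · have h1 : (j.succAbove l).succ = j.succ.succAbove l.succ := by
      rw [Fin.succ_succAbove_succ]
    rw [h1, insertPerm_succAbove, Fin.succAbove_of_le_castSucc _ _ hl]
    rcases hl.eq_or_lt with rfl | hl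
    -- The comparison of `v` with the entry after it. For `v = (τ j).succ` it becomes a weak
    -- inequality, which injectivity of `τ` makes strict.
    · rw [← Fin.succ_castSucc, insertPerm_self, Fin.succAbove_lt_iff_castSucc_lt]
      have hne : τ l.succ ≠ τ l.castSucc := fun h =>
        (Fin.castSucc_lt_succ (i := l)).ne' (τ.injective h)
      rcases hv with rfl | rfl
      · rw [Fin.castSucc_lt_succ_iff]
        exact ⟨fun h => lt_of_le_of_ne h hne, le_of_lt⟩
      · rw [Fin.castSucc_lt_castSucc_iff]
    · have h2 : l.succ.castSucc = j.succ.succAbove l.castSucc := by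
        rw [Fin.succAbove_of_le_castSucc]
        · rfl
        · exact hl
      rw [h2, insertPerm_succAbove, Fin.succAbove_lt_succAbove_iff]

/-- At an interior position the least value gives a descent then an ascent, the greatest an ascent
then a descent. Exchanging these two comparisons matches the counts. -/
theorem descents_insertPerm_zero_eq_last {n : ℕ} (q : Fin n) (τ : Perm (Fin (n + 1))) :
    descents (insertPerm q.succ.castSucc 0 τ) =
      descents (insertPerm q.succ.castSucc (Fin.last _) τ) := by
  rw [descents_eq_sum, descents_eq_sum, ← Equiv.sum_comp (swap q.castSucc q.succ)]
  refine Finset.sum_congr rfl fun l _ => ?_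
  set p : Fin (n + 2) := q.succ.castSucc with hp
  have hn (x : Fin (n + 2)) (hx : x ≠ p) : ∃ y, x = p.succAbove y := by
    obtain ⟨y, rfl⟩ := Fin.exists_succAbove_eq hx
    exact ⟨y, rfl⟩
  by_cases h1 : l = q.castSucc
  · subst h1
    obtain ⟨y, hy⟩ := hn q.succ.succ (by simp [hp, Fin.ext_iff])
    obtain ⟨z, hz⟩ := hn q.castSucc.castSucc (by simp [hp, Fin.ext_iff])
    rw [swap_apply_left, ← hp, hy, hz, Fin.succ_castSucc, ← hp]
    simp [(Fin.castSucc_lt_last _).le]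
  by_cases h2 : l = q.succ
  · subst h2
    obtain ⟨y, hy⟩ := hn q.succ.succ (by simp [hp, Fin.ext_iff])
    obtain ⟨z, hz⟩ := hn q.castSucc.castSucc (by simp [hp, Fin.ext_iff])
    rw [swap_apply_right, ← hp, hy, hz, Fin.succ_castSucc, ← hp]
    simp [Fin.castSucc_lt_last]
  · rw [swap_apply_of_ne_of_ne h1 h2]
    obtain ⟨y, hy⟩ := hn l.succ (by
      rw [hp, ← Fin.succ_castSucc, Ne, Fin.succ_inj]; exact h1)
    obtain ⟨z, hz⟩ := hn l.castSucc (by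
      rw [hp, Ne, Fin.castSucc_inj]; exact h2)
    rw [hy, hz]
    simp

/-- Exchanging two consecutive values alters only their comparison with each other, and the
hypotheses say that they never stand side by side. -/
theorem descents_swap_mul {n : ℕ} (i : Fin (n + 1)) (σ : Perm (Fin (n + 2)))
    (h1 : ∀ j : Fin (n + 1), ¬(σ j.castSucc = i.castSucc ∧ σ j.succ = i.succ))
    (h2 : ∀ j : Fin (n + 1), ¬(σ j.castSucc = i.succ ∧ σ j.succ = i.castSucc)) :
    descents (swap i.castSucc i.succ * σ) = descents σ := by
  rw [descents_eq_sum, descents_eq_sum]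
  refine Finset.sum_congr rfl fun j _ => if_congr ?_ rfl rfl
  have := h1 j
  have := h2 j
  simp only [Perm.mul_apply, swap_apply_def]
  have hne : σ j.castSucc ≠ σ j.succ := fun h => (Fin.castSucc_lt_succ (i := j)).ne (σ.injective h)
  generalize σ j.castSucc = x at *
  generalize σ j.succ = y at *
  simp only [Fin.ext_iff, Fin.val_castSucc, Fin.val_succ, ne_eq] at *
  split_ifs <;> simp only [Fin.lt_def, Fin.val_castSucc, Fin.val_succ] <;> omega

/-- The Pascal recursion for the polynomials defining the Eulerian idempotents. -/
theorem poly_sub_poly (n d : ℕ) : poly (n + 1) d - poly (n + 1) (d + 1) = poly n d := by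
  -- The two products share n factors. The remaining ones, X − d + n and X − d − 1, differ by n + 1,
  -- which turns 1/(n + 1)! into 1/n!.
  have h1 : ∏ s ∈ Finset.range (n + 1), (Polynomial.X - Polynomial.C ((d + 1 : ℕ) : ℚ) +
        Polynomial.C (s : ℚ)) =
      (∏ s ∈ Finset.range n, (Polynomial.X - Polynomial.C (d : ℚ) + Polynomial.C (s : ℚ))) *
        (Polynomial.X - Polynomial.C (d : ℚ) - 1) := by
    rw [Finset.prod_range_succ']
    congr 1
    · refine Finset.prod_congr rfl fun s _ => ?_
      push_cast
      simp only [map_add, map_one]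
      ring
    · push_cast
      simp only [map_add, map_one, map_zero]
      ring
  have h2 : Polynomial.C (((n + 1).factorial : ℚ)⁻¹) * ((n : Polynomial ℚ) + 1) =
      Polynomial.C ((n.factorial : ℚ)⁻¹) := by
    have : ((n : Polynomial ℚ) + 1) = Polynomial.C ((n : ℚ) + 1) := by simp
    rw [this, ← Polynomial.C_mul, Nat.factorial_succ]
    congr 1
    have : (n.factorial : ℚ) ≠ 0 := by positivity
    have : (n : ℚ) + 1 ≠ 0 := by positivity
    push_cast
    field_simp
  rw [poly, poly, poly, h1, Finset.prod_range_succ, ← h2]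
  simp only [map_natCast]
  ring

end Eulerian

/-! ### Cancellation in signed sums of faces over permutations -/

namespace Eulerian

open Equiv

section SignedSums

variable {k W : Type*} [CommRing k] [AddCommGroup W] [Module k W]

/-- The inner faces in a signed sum over permutations: the terms whose merged values do not come
from neighbouring positions cancel in pairs. -/
theorem sum_inner_faces {n : ℕ} {g g' : ℕ → k} (hg : ∀ d, g d - g (d + 1) = g' d)
    {T : Fin (n + 1) → Perm (Fin (n + 2)) → W} {R : Fin (n + 1) → Perm (Fin (n + 1)) → W}
    (hswap : ∀ i σ, T i (swap i.castSucc i.succ * σ) = T i σ)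
    (hadj : ∀ j τ v, v = (τ j).succ ∨ v = (τ j).castSucc →
      T (τ j) (insertPerm j.succ v τ) = R j τ) :
    ∑ i : Fin (n + 1), ∑ σ, ((-1) ^ (i : ℕ) * ((Perm.sign σ : ℤ) : k) * g (descents σ)) • T i σ =
      ∑ j : Fin (n + 1), ∑ τ,
        ((-1) ^ (j : ℕ) * ((Perm.sign τ : ℤ) : k) * g' (descents τ)) • R j τ := by
  classical
  set c : Fin (n + 1) × Perm (Fin (n + 2)) → W := fun x =>
    ((-1) ^ (x.1 : ℕ) * ((Perm.sign x.2 : ℤ) : k) * g (descents x.2)) • T x.1 x.2 with hc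
  let asc : Fin (n + 1) × Perm (Fin (n + 2)) → Prop := fun x =>
    ∃ j : Fin (n + 1), x.2 j.castSucc = x.1.castSucc ∧ x.2 j.succ = x.1.succ
  let desc : Fin (n + 1) × Perm (Fin (n + 2)) → Prop := fun x =>
    ∃ j : Fin (n + 1), x.2 j.castSucc = x.1.succ ∧ x.2 j.succ = x.1.castSucc
  -- Deleting position j + 1 recovers `τ`, with i = `τ j`. The face sign (-1)^(τ j) and the
  -- insertion sign (-1)^(j + 1 + τ j + 1) combine to (-1)^j.
  have hasc : ∑ x with asc x, c x = ∑ y : Fin (n + 1) × Perm (Fin (n + 1)),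
      ((-1) ^ (y.1 : ℕ) * ((Perm.sign y.2 : ℤ) : k) * g (descents y.2)) • R y.1 y.2 := by
    symm
    refine Finset.sum_bij (fun y _ => (y.2 y.1, insertPerm y.1.succ (y.2 y.1).succ y.2)) ?_ ?_ ?_ ?_
    · rintro ⟨j, τ⟩ -
      refine Finset.mem_filter.2 ⟨Finset.mem_univ _, j, ?_, ?_⟩
      · rw [insertPerm_succ_castSucc, Fin.succAbove_succ_self]
      · rw [insertPerm_self]
    · rintro ⟨j, τ⟩ - ⟨j', τ'⟩ - h
      simp only [Prod.mk.injEq] at h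
      obtain ⟨h1, h2⟩ := h
      rw [h1] at h2
      have := insertPerm_injective _ (a₁ := (j.succ, τ)) (a₂ := (j'.succ, τ')) h2
      simpa using this
    · rintro ⟨i, σ⟩ h
      obtain ⟨j, h1, h2⟩ := (Finset.mem_filter.1 h).2
      dsimp only at h1 h2
      obtain ⟨τ, rfl⟩ := exists_eq_insertPerm σ h2
      have h3 : τ j = i := by
        refine Fin.succAbove_right_injective (p := i.succ) ?_
        rw [Fin.succAbove_succ_self, ← insertPerm_succ_castSucc]
        exact h1
      exact ⟨(j, τ), Finset.mem_univ _, by simp [h3]⟩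
    · rintro ⟨j, τ⟩ -
      simp only [hc]
      rw [hadj _ _ _ (Or.inl rfl), descents_insertPerm_adjacent _ _ _ (Or.inl rfl),
        Fin.succAbove_succ_self, if_neg (Fin.castSucc_lt_succ).not_gt, zero_add, sign_insertPerm]
      congr 2
      simp only [Fin.val_succ]
      push_cast
      have := Even.neg_one_pow (α := k) (n := (τ j : ℕ) + τ j) ⟨_, rfl⟩
      rw [pow_add] at this
      linear_combination (-(-1) ^ (j : ℕ) * ((Perm.sign τ : ℤ) : k)) * this
  -- The inserted value is now lower by one, which flips the sign and adds a descent.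
  have hdesc : ∑ x with desc x, c x = ∑ y : Fin (n + 1) × Perm (Fin (n + 1)),
      (-((-1) ^ (y.1 : ℕ) * ((Perm.sign y.2 : ℤ) : k) * g (descents y.2 + 1))) • R y.1 y.2 := by
    symm
    refine Finset.sum_bij (fun y _ => (y.2 y.1, insertPerm y.1.succ (y.2 y.1).castSucc y.2))
      ?_ ?_ ?_ ?_
    · rintro ⟨j, τ⟩ -
      refine Finset.mem_filter.2 ⟨Finset.mem_univ _, j, ?_, ?_⟩
      · rw [insertPerm_succ_castSucc, Fin.succAbove_castSucc_self]
      · rw [insertPerm_self]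
    · rintro ⟨j, τ⟩ - ⟨j', τ'⟩ - h
      simp only [Prod.mk.injEq] at h
      obtain ⟨h1, h2⟩ := h
      rw [h1] at h2
      have := insertPerm_injective _ (a₁ := (j.succ, τ)) (a₂ := (j'.succ, τ')) h2
      simpa using this
    · rintro ⟨i, σ⟩ h
      obtain ⟨j, h1, h2⟩ := (Finset.mem_filter.1 h).2
      dsimp only at h1 h2
      obtain ⟨τ, rfl⟩ := exists_eq_insertPerm σ h2
      have h3 : τ j = i := by
        refine Fin.succAbove_right_injective (p := i.castSucc) ?_
        rw [Fin.succAbove_castSucc_self, ← insertPerm_succ_castSucc]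
        exact h1
      exact ⟨(j, τ), Finset.mem_univ _, by simp [h3]⟩
    · rintro ⟨j, τ⟩ -
      simp only [hc]
      rw [hadj _ _ _ (Or.inr rfl), descents_insertPerm_adjacent _ _ _ (Or.inr rfl),
        Fin.succAbove_castSucc_self, if_pos (Fin.castSucc_lt_succ), add_comm 1, sign_insertPerm]
      congr 1
      simp only [Fin.val_succ, Fin.val_castSucc]
      push_cast
      have := Even.neg_one_pow (α := k) (n := (τ j : ℕ) + τ j) ⟨_, rfl⟩
      rw [pow_add] at this
      linear_combination
        ((-1) ^ (j : ℕ) * ((Perm.sign τ : ℤ) : k) * g (descents τ + 1)) * this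
  -- Left multiplication by the transposition of i and i + 1 is a fixed-point-free involution here;
  -- it preserves `T` and descents and reverses the sign.
  have hrest : ∑ x with ¬asc x ∧ ¬desc x, c x = 0 := by
    have hmul (i : Fin (n + 1)) (σ : Perm (Fin (n + 2))) :
        swap i.castSucc i.succ * (swap i.castSucc i.succ * σ) = σ := by
      rw [← mul_assoc, swap_mul_self, one_mul]
    have happ (i : Fin (n + 1)) (σ : Perm (Fin (n + 2))) (x y) :
        (swap i.castSucc i.succ * σ) x = y ↔ σ x = swap i.castSucc i.succ y := by
      rw [Perm.mul_apply, ← Equiv.eq_symm_apply, symm_swap]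
    refine Finset.sum_involution (fun x _ => (x.1, swap x.1.castSucc x.1.succ * x.2)) ?_ ?_ ?_ ?_
    · rintro ⟨i, σ⟩ h
      obtain ⟨-, h1, h2⟩ := Finset.mem_filter.1 h
      simp only [hc]
      rw [hswap, descents_swap_mul i σ (fun j hj => h1 ⟨j, hj⟩) (fun j hj => h2 ⟨j, hj⟩),
        ← add_smul, Perm.sign_mul, Perm.sign_swap Fin.castSucc_lt_succ.ne]
      convert zero_smul k _
      push_cast
      ring
    · rintro ⟨i, σ⟩ - - h
      simp only [Prod.mk.injEq, true_and] at h
      exact Fin.castSucc_lt_succ.ne (swap_eq_one_iff.1 (mul_eq_right.1 h))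
    · rintro ⟨i, σ⟩ h
      obtain ⟨-, h1, h2⟩ := Finset.mem_filter.1 h
      refine Finset.mem_filter.2 ⟨Finset.mem_univ _, ?_, ?_⟩
      · rintro ⟨j, hj⟩
        simp only [happ, swap_apply_left, swap_apply_right] at hj
        exact h2 ⟨j, hj⟩
      · rintro ⟨j, hj⟩
        simp only [happ, swap_apply_left, swap_apply_right] at hj
        exact h1 ⟨j, hj⟩
    · rintro ⟨i, σ⟩ -
      simp only [hmul]
  have hdisj (x) (h : asc x) : ¬desc x := by
    obtain ⟨i, σ⟩ := x
    rintro ⟨j', h1', h2'⟩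
    obtain ⟨j, h1, h2⟩ := h
    have e1 := σ.injective (h1.trans h2'.symm)
    have e2 := σ.injective (h2.trans h1'.symm)
    simp only [Fin.ext_iff, Fin.val_castSucc, Fin.val_succ] at e1 e2
    omega
  rw [← Finset.sum_product', ← Finset.sum_product', Finset.univ_product_univ,
    Finset.univ_product_univ]
  have hsplit : ∑ x, c x = ∑ x with asc x, c x + ∑ x with desc x, c x := by
    rw [← Finset.sum_filter_add_sum_filter_not Finset.univ asc]
    congr 1
    rw [← Finset.sum_filter_add_sum_filter_not _ desc, Finset.filter_filter, Finset.filter_filter,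
      hrest, add_zero]
    refine Finset.sum_congr (Finset.filter_congr fun x _ => ?_) fun _ _ => rfl
    exact ⟨fun h => h.2, fun h => ⟨fun h' => hdisj x h' h, h⟩⟩
  refine hsplit.trans ?_
  rw [hasc, hdesc, ← Finset.sum_add_distrib]
  refine Finset.sum_congr rfl fun y _ => ?_
  rw [← hg, ← add_smul]
  congr 1
  ring

/-- The two outer faces in a signed sum over permutations: the terms in which the absorbed factor
is neither the first nor the last one cancel. -/
theorem sum_outer_faces {n : ℕ} {g g' : ℕ → k} (hg : ∀ d, g d - g (d + 1) = g' d)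
    {T T' : Perm (Fin (n + 2)) → W} {R R' : Perm (Fin (n + 1)) → W}
    (hout : ∀ p τ, T (insertPerm p 0 τ) = T' (insertPerm p (Fin.last _) τ))
    (h0 : ∀ τ, T (insertPerm 0 0 τ) = R τ)
    (hl : ∀ τ, T' (insertPerm (Fin.last _) (Fin.last _) τ) = R' τ) :
    ∑ σ, (((Perm.sign σ : ℤ) : k) * g (descents σ)) • T σ +
        ∑ σ, ((-1) ^ (n + 2) * ((Perm.sign σ : ℤ) : k) * g (descents σ)) • T' σ =
      ∑ τ, (((Perm.sign τ : ℤ) : k) * g' (descents τ)) • R τ +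
        ∑ τ, ((-1) ^ (n + 2) * ((Perm.sign τ : ℤ) : k) * g' (descents τ)) • R' τ := by
  have e (x : ℕ) : ((-1 : k) ^ x) * (-1) ^ x = 1 := by
    rw [← pow_add]
    exact Even.neg_one_pow ⟨x, rfl⟩
  -- `p` is the original position of the absorbed factor. By `hout` both outer faces give the same
  -- vector, so their coefficients add.
  let F : Fin (n + 2) → Perm (Fin (n + 1)) → W := fun p τ =>
    (((Perm.sign (insertPerm p 0 τ) : ℤ) : k) * g (descents (insertPerm p 0 τ)) +
      (-1) ^ (n + 2) * ((Perm.sign (insertPerm p (Fin.last _) τ) : ℤ) : k) *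
        g (descents (insertPerm p (Fin.last _) τ))) • T (insertPerm p 0 τ)
  have hF : ∑ σ, (((Perm.sign σ : ℤ) : k) * g (descents σ)) • T σ +
      ∑ σ, ((-1) ^ (n + 2) * ((Perm.sign σ : ℤ) : k) * g (descents σ)) • T' σ =
      ∑ p, ∑ τ, F p τ := by
    rw [← Finset.sum_product', Finset.univ_product_univ,
      ← Function.Bijective.sum_comp (insertPerm_bijective (0 : Fin (n + 2))),
      ← Function.Bijective.sum_comp (insertPerm_bijective (Fin.last (n + 1))),
      ← Finset.sum_add_distrib]
    refine Finset.sum_congr rfl fun x _ => ?_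
    rw [← hout, ← add_smul]
  have hzero (τ) : F 0 τ = (((Perm.sign τ : ℤ) : k) * g' (descents τ)) • R τ := by
    simp only [F]
    rw [h0, descents_insertPerm_zero, descents_insertPerm_zero, if_neg (Fin.not_lt_zero _),
      if_pos (by simp [Fin.castSucc_lt_last]), ← hg, sign_insertPerm, sign_insertPerm]
    congr 1
    simp only [Fin.val_zero, Fin.val_last]
    push_cast
    rw [add_comm 1 (descents τ), zero_add]
    linear_combination (-((Perm.sign τ : ℤ) : k) * g (descents τ + 1)) * e n
  have hlast (τ) : F (Fin.last _) τ =
      ((-1) ^ (n + 2) * ((Perm.sign τ : ℤ) : k) * g' (descents τ)) • R' τ := by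
    simp only [F]
    rw [hout, hl, descents_insertPerm_last, descents_insertPerm_last,
      if_neg (Fin.le_last _).not_gt, if_pos (by simp), ← hg, sign_insertPerm, sign_insertPerm]
    congr 1
    simp only [Fin.val_zero, Fin.val_last]
    push_cast
    linear_combination ((-1) ^ n * ((Perm.sign τ : ℤ) : k) * g (descents τ)) * e (n + 1)
  -- The insertion signs for values 0 and n + 1 differ by (-1)^(n + 1); with the face sign (-1)^(n +
  -- 2) this leaves -1, and the descent numbers agree.
  have hmid (q : Fin n) (τ) : F q.succ.castSucc τ = 0 := by
    simp only [F]
    rw [descents_insertPerm_zero_eq_last, sign_insertPerm, sign_insertPerm]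
    convert zero_smul k _
    simp only [Fin.val_zero, Fin.val_last]
    push_cast
    simp only [pow_add]
    linear_combination (-((-1) ^ (q.succ.castSucc : ℕ) * ((Perm.sign τ : ℤ) : k) *
      g (descents (insertPerm q.succ.castSucc (Fin.last _) τ)))) * e n
  rw [hF, Fin.sum_univ_castSucc, Fin.sum_univ_succ]
  simp only [Fin.castSucc_zero, hzero, hmid, hlast, Finset.sum_const_zero, add_zero]

/-- The combinatorial core of `boundary_action`: `T j σ` stands for the j-th face of a permuted
tensor, `R j τ` for the permuted j-th face. -/
theorem sum_faces {n : ℕ} {g g' : ℕ → k} (hg : ∀ d, g d - g (d + 1) = g' d)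
    {T : Fin (n + 3) → Perm (Fin (n + 2)) → W} {R : Fin (n + 3) → Perm (Fin (n + 1)) → W}
    (hswap : ∀ (i : Fin (n + 1)) σ,
      T i.castSucc.succ (swap i.castSucc i.succ * σ) = T i.castSucc.succ σ)
    (hadj : ∀ (j : Fin (n + 1)) τ v, v = (τ j).succ ∨ v = (τ j).castSucc →
      T (τ j).castSucc.succ (insertPerm j.succ v τ) = R j.castSucc.succ τ)
    (hout : ∀ p τ, T 0 (insertPerm p 0 τ) = T (Fin.last _) (insertPerm p (Fin.last _) τ))
    (h0 : ∀ τ, T 0 (insertPerm 0 0 τ) = R 0 τ)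
    (hl : ∀ τ, T (Fin.last _) (insertPerm (Fin.last _) (Fin.last _) τ) = R (Fin.last _) τ) :
    ∑ i : Fin (n + 3), ∑ σ,
        ((-1) ^ (i : ℕ) * ((Perm.sign σ : ℤ) : k) * g (descents σ)) • T i σ =
      ∑ j : Fin (n + 3), ∑ τ,
        ((-1) ^ (j : ℕ) * ((Perm.sign τ : ℤ) : k) * g' (descents τ)) • R j τ := by
  have ho := sum_outer_faces hg hout h0 hl
  -- The inner face merging slots i and i + 1 has number i + 1 in the boundary, hence the extra
  -- sign.
  have hi := congrArg (fun x => -x) (sum_inner_faces hg hswap hadj)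
  simp only [← Finset.sum_neg_distrib, ← neg_smul] at hi
  rw [Fin.sum_univ_succ, Fin.sum_univ_castSucc, Fin.sum_univ_succ (n := n + 2),
    Fin.sum_univ_castSucc (n := n + 1)]
  simp only [Fin.val_zero, pow_zero, one_mul, Fin.succ_last, Fin.val_last, Fin.val_succ,
    Fin.val_castSucc, pow_succ _ (Fin.val _), mul_neg, mul_one, neg_mul]
  simp only [Nat.succ_eq_add_one] at hi ho ⊢
  rw [hi, add_left_comm, ho, add_left_comm]

end SignedSums

end Eulerian

namespace Hochschild

open Equiv Eulerian

/-! ### Compatibility of the faces with permutations -/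

section Faces

set_option linter.unusedSectionVars false

variable {k : Type*} [CommRing k]
  {B : Type*} [NonUnitalRing B] [Module k B] [IsScalarTower k B B] [SMulCommClass k B B]
  {A : Type*} [Ring A] [Algebra k A]
  (ι : B →ₙₐ[k] A)
  (M : Type*) [AddCommGroup M] [Module k M] [Module A M] [Module Aᵐᵒᵖ M]
  [IsScalarTower k A M] [IsScalarTower k Aᵐᵒᵖ M]

theorem faceArgs_zero {n : ℕ} (a : Fin (n + 1) → B) (x : Fin n) :
    faceArgs 0 a x = a (Fin.succAbove 0 x) := by
  simp [faceArgs]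

theorem faceArgs_last {n : ℕ} (a : Fin (n + 1) → B) (x : Fin n) :
    faceArgs (Fin.last _) a x = a ((Fin.last _).succAbove x) := by
  simp [faceArgs]

theorem faceArgs_inner {n : ℕ} (j : Fin n) (a : Fin (n + 1) → B) (x : Fin n) :
    faceArgs j.castSucc.succ a x =
      if x = j then a j.castSucc * a j.succ else a (j.succ.succAbove x) := by
  rcases lt_trichotomy x j with h | rfl | h
  · rw [if_neg h.ne, Fin.succAbove_of_castSucc_lt _ _ (by
      rw [Fin.castSucc_lt_succ_iff]; exact h.le)]
    rw [Fin.lt_def] at h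
    simp [faceArgs, h]
  · simp [faceArgs]
  · rw [if_neg h.ne', Fin.succAbove_of_le_castSucc _ _ (by
      rw [Fin.succ_le_castSucc_iff]; exact h)]
    rw [Fin.lt_def] at h
    simp [faceArgs, h.not_gt, h.ne']

theorem faceCoeff_zero {n : ℕ} (a : Fin (n + 1) → B) (m : M) :
    faceCoeff ι M 0 a m = MulOpposite.op (ι (a 0)) • m := by
  simp [faceCoeff]

theorem faceCoeff_last {n : ℕ} (a : Fin (n + 1) → B) (m : M) :
    faceCoeff ι M (Fin.last _) a m = ι (a (Fin.last n)) • m := by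
  simp [faceCoeff]

theorem faceCoeff_inner {n : ℕ} (j : Fin n) (a : Fin (n + 1) → B) (m : M) :
    faceCoeff ι M j.castSucc.succ a m = m := by
  have h : j.castSucc.succ ≠ Fin.last (n + 1) := by
    rw [Fin.succ_castSucc]
    exact (Fin.castSucc_lt_last _).ne
  simp [faceCoeff, Fin.succ_ne_zero, h]

theorem faceArgs_inner_swap {n : ℕ} (hB : ∀ x y : B, x * y = y * x) (i : Fin n)
    (a : Fin (n + 1) → B) :
    faceArgs i.castSucc.succ (a ∘ swap i.castSucc i.succ) = faceArgs i.castSucc.succ a := by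
  funext x
  rw [faceArgs_inner, faceArgs_inner]
  split_ifs with h
  · simp [hB (a i.castSucc)]
  · rw [Function.comp_apply, swap_apply_of_ne_of_ne _ (Fin.succAbove_ne _ _)]
    intro h'
    rw [← Fin.succAbove_succ_self] at h'
    exact h (Fin.succAbove_right_injective h')

/-- The factors merged after permuting are the original neighbours j and j + 1, in reversed order
when `v` lies below `τ j`; commutativity absorbs the reversal. -/
theorem faceArgs_insertPerm_inner {n : ℕ} (hB : ∀ x y : B, x * y = y * x)
    (j : Fin n) (τ : Perm (Fin n)) (v : Fin (n + 1))
    (hv : v = (τ j).succ ∨ v = (τ j).castSucc) (a : Fin (n + 1) → B) :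
    faceArgs (τ j).castSucc.succ (a ∘ (insertPerm j.succ v τ).symm) =
      faceArgs j.castSucc.succ a ∘ τ.symm := by
  funext y
  obtain ⟨x, rfl⟩ := τ.surjective y
  have h1 (l) : (insertPerm j.succ v τ).symm (v.succAbove (τ l)) = j.succ.succAbove l := by
    rw [Equiv.symm_apply_eq, insertPerm_succAbove]
  have h2 : (insertPerm j.succ v τ).symm v = j.succ := by
    rw [Equiv.symm_apply_eq, insertPerm_self]
  rw [Function.comp_apply, Equiv.symm_apply_apply, faceArgs_inner, faceArgs_inner]
  simp only [EmbeddingLike.apply_eq_iff_eq, Function.comp_apply]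
  have h3 := h1 j
  rw [Fin.succAbove_succ_self] at h3
  split_ifs with hx
  · rcases hv with rfl | rfl
    · rw [Fin.succAbove_succ_self] at h3
      rw [h2, h3]
    · rw [Fin.succAbove_castSucc_self] at h3
      rw [h2, h3, hB]
  · rw [← h1 x]
    congr 2
    rcases hv with rfl | rfl
    · rfl
    · have hne : τ x ≠ τ j := fun h => hx (τ.injective h)
      generalize τ x = s at *
      generalize τ j = t at *
      rcases lt_or_gt_of_ne hne with h | h
      · rw [Fin.succAbove_of_castSucc_lt _ _ (Fin.castSucc_lt_succ_iff.2 h.le),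
          Fin.succAbove_of_castSucc_lt _ _ (Fin.castSucc_lt_castSucc_iff.2 h)]
      · rw [Fin.succAbove_of_le_castSucc _ _ (Fin.succ_le_castSucc_iff.2 h),
          Fin.succAbove_of_le_castSucc _ _ (Fin.castSucc_le_castSucc_iff.2 h.le)]

theorem faceArgs_insertPerm_zero {n : ℕ} (p : Fin (n + 1)) (τ : Perm (Fin n))
    (a : Fin (n + 1) → B) :
    faceArgs 0 (a ∘ (insertPerm p 0 τ).symm) = (fun x => a (p.succAbove x)) ∘ τ.symm := by
  funext y
  obtain ⟨x, rfl⟩ := τ.surjective y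
  rw [faceArgs_zero, Function.comp_apply, ← insertPerm_succAbove p, Equiv.symm_apply_apply,
    Function.comp_apply, Equiv.symm_apply_apply]

theorem faceArgs_insertPerm_last {n : ℕ} (p : Fin (n + 1)) (τ : Perm (Fin n))
    (a : Fin (n + 1) → B) :
    faceArgs (Fin.last _) (a ∘ (insertPerm p (Fin.last _) τ).symm) =
      (fun x => a (p.succAbove x)) ∘ τ.symm := by
  funext y
  obtain ⟨x, rfl⟩ := τ.surjective y
  rw [faceArgs_last, Function.comp_apply, ← insertPerm_succAbove p, Equiv.symm_apply_apply,
    Function.comp_apply, Equiv.symm_apply_apply]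

theorem insertPerm_symm_self {n : ℕ} (p v : Fin (n + 1)) (τ : Perm (Fin n)) :
    (insertPerm p v τ).symm v = p := by
  rw [Equiv.symm_apply_eq, insertPerm_self]

theorem boundary_elem {n : ℕ} (m : M) (a : Fin (n + 1) → B) :
    boundary ι M n (elem k m a) = ∑ i : Fin (n + 2),
      ((-1 : k) ^ (i : ℕ)) • elem k (faceCoeff ι M i a m) (faceArgs i a) := by
  simp only [boundary, LinearMap.sum_apply, LinearMap.smul_apply, face_elem]
  refine Finset.sum_congr rfl fun i _ => ?_
  rw [← Int.cast_smul_eq_zsmul k]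
  simp

/-- The two faces are ma and am, equal for symmetric M. This is why the weight `w` given to degree 0
does not matter. -/
theorem boundary_zero [IsCentralScalar A M] :
    (boundary ι M 0 : Chains k B M 1 →ₗ[k] Chains k B M 0) = 0 := by
  refine chains_hom_ext M fun m a => ?_
  rw [boundary_elem, Fin.sum_univ_two, LinearMap.zero_apply, show (1 : Fin 2) = Fin.last 1 from rfl,
    faceCoeff_zero, faceCoeff_last, op_smul_eq_smul,
    Subsingleton.elim (faceArgs (Fin.last 1) a) (faceArgs 0 a)]
  simp

/-! ### The boundary and the Eulerian idempotents -/

variable [Algebra ℚ k]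

theorem action_elem {B M : Type*} [AddCommGroup B] [Module k B]
    [AddCommGroup M] [Module k M] {n : ℕ} (e : MonoidAlgebra ℚ (Perm (Fin n))) (m : M)
    (a : Fin n → B) :
    action (k := k) e (elem k m a) =
      ∑ σ : Perm (Fin n), algebraMap ℚ k (e.coeff σ) • elem k m (a ∘ σ.symm) := by
  simp only [action, LinearMap.sum_apply, LinearMap.smul_apply, elem, LinearMap.lTensor_tmul,
    LinearEquiv.coe_coe]
  refine Finset.sum_congr rfl fun σ _ => ?_
  congr 2
  exact PiTensorProduct.reindex_tprod σ a

theorem idempotent_coeff (w n i : ℕ) (σ : Perm (Fin (n + 1))) :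
    (idempotent w (n + 1) i).coeff σ =
      ((Perm.sign σ : ℤ) : ℚ) * (poly (n + 1) (descents σ)).coeff i := by
  classical
  simp only [idempotent, MonoidAlgebra.coeff_sum, MonoidAlgebra.coeff_single,
    Finsupp.finsetSum_apply, Finsupp.single_apply]
  simp

/-- The boundary commutes with the Eulerian idempotents. -/
theorem boundary_action [IsCentralScalar A M] (hB : ∀ x y : B, x * y = y * x) (w i n : ℕ)
    (x : Chains k B M (n + 1)) :
    boundary ι M n (action (idempotent w (n + 1) i) x) =
      action (idempotent w n i) (boundary ι M n x) := by
  cases n with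
  | zero => simp [boundary_zero]
  | succ n =>
  suffices h : (boundary ι M (n + 1) : Chains k B M (n + 2) →ₗ[k] _) ∘ₗ
      action (idempotent w (n + 2) i) = action (idempotent w (n + 1) i) ∘ₗ boundary ι M (n + 1) from
    LinearMap.congr_fun h x
  refine chains_hom_ext M fun m a => ?_
  have key := sum_faces (n := n) (k := k)
    (g := fun d => algebraMap ℚ k ((poly (n + 2) d).coeff i))
    (g' := fun d => algebraMap ℚ k ((poly (n + 1) d).coeff i))
    (fun d => by rw [← map_sub, ← Polynomial.coeff_sub, poly_sub_poly])
    (T := fun j σ => elem k (faceCoeff ι M j (a ∘ σ.symm) m) (faceArgs j (a ∘ σ.symm)))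
    (R := fun j τ => elem k (faceCoeff ι M j a m) (faceArgs j a ∘ τ.symm))
    (fun j σ => by
      simp only [faceCoeff_inner]
      congr 1
      rw [← faceArgs_inner_swap hB j (a ∘ σ.symm)]
      rfl)
    (fun j τ v hv => by
      simp only [faceCoeff_inner, faceArgs_insertPerm_inner hB j τ v hv])
    (fun p τ => by
      simp only [faceCoeff_zero, faceCoeff_last, faceArgs_insertPerm_zero,
        faceArgs_insertPerm_last, Function.comp_apply, insertPerm_symm_self, op_smul_eq_smul])
    (fun τ => by
      simp only [faceCoeff_zero, faceArgs_insertPerm_zero, Function.comp_apply,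
        insertPerm_symm_self]
      congr 2)
    (fun τ => by
      simp only [faceCoeff_last, faceArgs_insertPerm_last, Function.comp_apply,
        insertPerm_symm_self]
      congr 2
      funext x
      rw [faceArgs_last])
  simp only [LinearMap.comp_apply, action_elem, boundary_elem, map_sum, map_smul, idempotent_coeff,
    Finset.smul_sum, smul_smul, map_mul, map_intCast]
  rw [Finset.sum_comm]
  refine Eq.trans ?_ (key.trans ?_)
  · refine Finset.sum_congr rfl fun _ _ => Finset.sum_congr rfl fun _ _ => ?_
    congr 1
    ring
  · refine Finset.sum_congr rfl fun _ _ => Finset.sum_congr rfl fun _ _ => ?_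
    congr 1
    ring

end Faces

end Hochschild

namespace Hochschild

open Equiv Eulerian

/-! ### Functoriality in the tensor factors -/

section Functoriality

variable {k : Type*} [CommRing k] {B B' : Type*} [AddCommGroup B] [Module k B]
  [AddCommGroup B'] [Module k B'] (M : Type*) [AddCommGroup M] [Module k M]

/-- The map `M ⊗ B^{⊗ n} → M ⊗ B'^{⊗ n}` induced by a linear map `B → B'`. -/
noncomputable def chainsMap (φ : B →ₗ[k] B') (n : ℕ) : Chains k B M n →ₗ[k] Chains k B' M n :=
  LinearMap.lTensor M (PiTensorProduct.map fun _ => φ)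

@[simp]
theorem chainsMap_elem (φ : B →ₗ[k] B') {n : ℕ} (m : M) (a : Fin n → B) :
    chainsMap M φ n (elem k m a) = elem k m (φ ∘ a) := by
  simp only [chainsMap, elem, LinearMap.lTensor_tmul, PiTensorProduct.map_tprod]
  rfl

theorem chainsMap_action [Algebra ℚ k] {B B' : Type*} [NonUnitalRing B] [Module k B]
    [NonUnitalRing B'] [Module k B'] [IsScalarTower k B B] [SMulCommClass k B B]
    (φ : B →ₗ[k] B') {n : ℕ} (e : MonoidAlgebra ℚ (Perm (Fin n))) (x : Chains k B M n) :
    chainsMap M φ n (action e x) = action e (chainsMap M φ n x) := by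
  suffices h : chainsMap M φ n ∘ₗ action e = action e ∘ₗ chainsMap M φ n from
    LinearMap.congr_fun h x
  refine chains_hom_ext M fun m a => ?_
  simp only [LinearMap.comp_apply, action_elem, chainsMap_elem, map_sum, map_smul,
    Function.comp_assoc]

/-- Faces involve only products and the action through `ι`, both respected by a multiplicative map.
-/
theorem chainsMap_boundary {B A : Type*} [NonUnitalRing B] [Module k B] [IsScalarTower k B B]
    [SMulCommClass k B B] [Ring A] [Algebra k A] [Module A M] [Module Aᵐᵒᵖ M] [IsScalarTower k A M]
    [IsScalarTower k Aᵐᵒᵖ M] (ι : B →ₙₐ[k] A) (n : ℕ) (x : Chains k B M (n + 1)) :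
    chainsMap M (ι : B →ₗ[k] A) n (boundary ι M n x) =
      boundary (NonUnitalAlgHom.id k A) M n (chainsMap M (ι : B →ₗ[k] A) (n + 1) x) := by
  suffices h : chainsMap M (ι : B →ₗ[k] A) n ∘ₗ boundary ι M n =
      boundary (NonUnitalAlgHom.id k A) M n ∘ₗ chainsMap M (ι : B →ₗ[k] A) (n + 1) from
    LinearMap.congr_fun h x
  refine chains_hom_ext M fun m a => ?_
  have h1 (i : Fin (n + 2)) : (ι : B →ₗ[k] A) ∘ faceArgs i a =
      faceArgs i ((ι : B →ₗ[k] A) ∘ a) := by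
    funext j
    simp only [Function.comp_apply, faceArgs]
    split_ifs <;> simp
  have h2 (i : Fin (n + 2)) : faceCoeff ι M i a =
      faceCoeff (NonUnitalAlgHom.id k A) M i ((ι : B →ₗ[k] A) ∘ a) := by
    simp [faceCoeff]
  simp only [LinearMap.comp_apply, boundary_elem, chainsMap_elem, map_sum, map_smul, h1, h2]

end Functoriality

/-! ### The degenerate subcomplex -/

section Degenerate

variable {k A M : Type*} [CommRing k] [Ring A] [Algebra k A] [AddCommGroup M] [Module k M]

theorem elem_mem_degenerate {n : ℕ} (m : M) {a : Fin n → A} {j : Fin n} (h : a j = 1) :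
    elem k m a ∈ degenerate k A M n :=
  Submodule.subset_span ⟨m, a, ⟨j, h⟩, rfl⟩

theorem elem_mem_degenerate_of_eq_smul {n : ℕ} (m : M) {a : Fin n → A} {j : Fin n} {c : k}
    (h : a j = c • 1) : elem k m a ∈ degenerate k A M n := by
  classical
  have : elem k m a = c • elem k m (Function.update a j 1) := by
    have h' : a = Function.update a j (c • 1) := by rw [← h, Function.update_eq_self]
    conv_lhs => rw [h']
    simp only [elem, MultilinearMap.map_update_smul, TensorProduct.tmul_smul]
  rw [this]
  exact Submodule.smul_mem _ _ (elem_mem_degenerate m (j := j) (by simp))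

theorem action_mem_degenerate [Algebra ℚ k] {n : ℕ} (e : MonoidAlgebra ℚ (Perm (Fin n)))
    {x : Chains k A M n} (hx : x ∈ degenerate k A M n) : action e x ∈ degenerate k A M n := by
  suffices h : degenerate k A M n ≤ (degenerate k A M n).comap (action e) from h hx
  refine Submodule.span_le.2 ?_
  rintro _ ⟨m, a, ⟨j, hj⟩, rfl⟩
  rw [SetLike.mem_coe, Submodule.mem_comap, action_elem]
  exact Submodule.sum_mem _ fun σ _ => Submodule.smul_mem _ _
    (elem_mem_degenerate m (j := σ j) (by simpa using hj))

/-- The two faces that multiply the factor 1 into a neighbour, or into the coefficient at an end,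
coincide and carry opposite signs. Every other face keeps that factor. -/
theorem boundary_mem_degenerate [Module A M] [Module Aᵐᵒᵖ M] [IsScalarTower k A M]
    [IsScalarTower k Aᵐᵒᵖ M] {n : ℕ} {x : Chains k A M (n + 1)}
    (hx : x ∈ degenerate k A M (n + 1)) :
    boundary (NonUnitalAlgHom.id k A) M n x ∈ degenerate k A M n := by
  suffices h : degenerate k A M (n + 1) ≤
      (degenerate k A M n).comap (boundary (NonUnitalAlgHom.id k A) M n) from h hx
  refine Submodule.span_le.2 ?_
  rintro _ ⟨m, a, ⟨j, hj⟩, rfl⟩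
  rw [SetLike.mem_coe, Submodule.mem_comap, boundary_elem]
  have hne : j.succ ≠ j.castSucc := Fin.castSucc_lt_succ.ne'
  rw [← Finset.add_sum_erase _ _ (Finset.mem_univ j.castSucc),
    ← Finset.add_sum_erase _ _ (Finset.mem_erase.2 ⟨hne, Finset.mem_univ j.succ⟩), ← add_assoc]
  have hc1 : faceCoeff (NonUnitalAlgHom.id k A) M j.castSucc a m = m := by
    rw [faceCoeff, if_neg (Fin.castSucc_lt_last j).ne]
    split_ifs with h
    · obtain rfl : j = 0 := Fin.ext (Fin.ext_iff.1 h :)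
      simp [hj]
    · rfl
  have hc2 : faceCoeff (NonUnitalAlgHom.id k A) M j.succ a m = m := by
    rw [faceCoeff, if_neg (Fin.succ_ne_zero j)]
    split_ifs with h
    · obtain rfl : j = Fin.last n := by simpa [Fin.ext_iff] using h
      simp [hj]
    · rfl
  have hargs : faceArgs j.castSucc a = faceArgs j.succ a := by
    funext l
    obtain ⟨j, hj'⟩ := j
    obtain ⟨l, hl⟩ := l
    simp only [faceArgs, Fin.castSucc_mk, Fin.succ_mk]
    rcases lt_trichotomy (l + 1) j with h | rfl | h
    · rw [if_pos h, if_pos (by omega)]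
    · rw [if_neg (lt_irrefl _), if_pos rfl, if_pos (by omega), hj, mul_one]
    · rw [if_neg (by omega), if_neg (by omega), if_neg (by omega)]
      split_ifs with h'
      · obtain rfl : l = j := by omega
        rw [hj, one_mul]
      · rfl
  rw [hc1, hc2, hargs, ← add_smul, Fin.val_succ, Fin.val_castSucc, pow_succ, mul_neg_one,
    add_neg_cancel, zero_smul, zero_add]
  refine Submodule.sum_mem _ fun i hi => Submodule.smul_mem _ _ ?_
  simp only [Finset.mem_erase, Finset.mem_univ, and_true, ne_eq, Fin.ext_iff, Fin.val_succ,
    Fin.val_castSucc] at hi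
  obtain ⟨i, hi'⟩ := i
  obtain ⟨j, hj'⟩ := j
  dsimp only at hi
  -- A face to the left of the factor 1 shifts it down one slot; a face to the right leaves it in
  -- place.
  rcases lt_or_gt_of_ne hi.2 with h | h
  · refine elem_mem_degenerate _ (j := ⟨j - 1, by omega⟩) ?_
    simp only [faceArgs]
    rw [if_neg (by omega), if_neg (by omega), ← hj]
    congr 1
    ext
    simp only [Fin.val_succ]
    omega
  · refine elem_mem_degenerate _ (j := ⟨j, by omega⟩) ?_
    simp only [faceArgs]
    rw [if_pos (by omega)]
    exact hj

end Degenerate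

/-! ### The projection onto the augmentation ideal -/

section Augmentation

variable {k A : Type*} [CommRing k] [Ring A] [Algebra k A] (ε : A →ₐ[k] k)

theorem mem_augmentationIdeal {a : A} : a ∈ augmentationIdeal ε ↔ ε a = 0 := Iff.rfl

/-- The projection `a ↦ a - ε a` of `A` onto the augmentation ideal. -/
def augmentationProj : A →ₗ[k] augmentationIdeal ε where
  toFun a := ⟨a - algebraMap k A (ε a), by simp [mem_augmentationIdeal]⟩
  map_add' a b := by
    ext
    simp only [map_add, NonUnitalSubalgebra.coe_add]
    abel
  map_smul' c a := by
    ext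
    simp [Algebra.smul_def, mul_sub]

theorem augmentationProj_one : augmentationProj ε 1 = 0 := by
  ext
  simp [augmentationProj]

theorem augmentationProj_coe (a : augmentationIdeal ε) : augmentationProj ε a = a := by
  ext
  simp [augmentationProj, (mem_augmentationIdeal ε).1 a.2]

/-- The inclusion of the augmentation ideal. -/
abbrev augmentationIncl : augmentationIdeal ε →ₗ[k] A :=
  ((NonUnitalSubalgebraClass.subtype (augmentationIdeal ε) : augmentationIdeal ε →ₙₐ[k] A) :
    augmentationIdeal ε →ₗ[k] A)

theorem eq_augmentationIncl_add (a : A) :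
    a = ε a • (1 : A) + augmentationIncl ε (augmentationProj ε a) := by
  simp [augmentationProj, Algebra.algebraMap_eq_smul_one]

variable {M : Type*} [AddCommGroup M] [Module k M]

theorem chainsMap_proj_incl {n : ℕ} (x : Chains k (augmentationIdeal ε) M n) :
    chainsMap M (augmentationProj ε) n (chainsMap M (augmentationIncl ε) n x) = x := by
  suffices h : chainsMap M (augmentationProj ε) n ∘ₗ chainsMap M (augmentationIncl ε) n =
      LinearMap.id from LinearMap.congr_fun h x
  refine chains_hom_ext M fun m a => ?_
  simp only [LinearMap.comp_apply, chainsMap_elem, LinearMap.id_apply]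
  congr 1
  funext j
  exact augmentationProj_coe ε (a j)

theorem chainsMap_proj_eq_zero {n : ℕ} {x : Chains k A M n} (hx : x ∈ degenerate k A M n) :
    chainsMap M (augmentationProj ε) n x = 0 := by
  suffices h : degenerate k A M n ≤ LinearMap.ker (chainsMap M (augmentationProj ε) n) from h hx
  refine Submodule.span_le.2 ?_
  rintro _ ⟨m, a, ⟨j, hj⟩, rfl⟩
  rw [SetLike.mem_coe, LinearMap.mem_ker, chainsMap_elem, elem,
    MultilinearMap.map_coord_zero _ j (by simp [hj, augmentationProj_one]), TensorProduct.tmul_zero]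

/-- In the multilinear expansion, `s` is the set of slots taking the scalar part ε(a)·1. The term `s
= ∅` is the one subtracted, and any other has a slot proportional to 1. -/
theorem sub_chainsMap_mem_degenerate {n : ℕ} (x : Chains k A M n) :
    x - chainsMap M (augmentationIncl ε) n (chainsMap M (augmentationProj ε) n x) ∈
      degenerate k A M n := by
  classical
  suffices h : (degenerate k A M n).mkQ ∘ₗ
      (LinearMap.id - chainsMap M (augmentationIncl ε) n ∘ₗ chainsMap M (augmentationProj ε) n) =
      0 from (Submodule.Quotient.mk_eq_zero _).1 (LinearMap.congr_fun h x)
  refine chains_hom_ext M fun m a => ?_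
  refine (Submodule.Quotient.mk_eq_zero _).2 ?_
  set b : Fin n → A := augmentationIncl ε ∘ augmentationProj ε ∘ a with hb
  have ha : a = (fun j => ε (a j) • (1 : A)) + b := funext fun j => eq_augmentationIncl_add ε (a j)
  have hsum : elem k m a =
      ∑ s : Finset (Fin n), elem k m (s.piecewise (fun j => ε (a j) • (1 : A)) b) := by
    conv_lhs => rw [ha]
    simp only [elem, MultilinearMap.map_add_univ, TensorProduct.tmul_sum]
  simp only [LinearMap.sub_apply, LinearMap.id_apply, LinearMap.comp_apply, chainsMap_elem]
  rw [← hb, hsum, ← Finset.add_sum_erase _ _ (Finset.mem_univ ∅), Finset.piecewise_empty,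
    add_sub_cancel_left]
  refine Submodule.sum_mem _ fun s hs => ?_
  obtain ⟨j, hj⟩ := Finset.nonempty_iff_ne_empty.2 (Finset.ne_of_mem_erase hs)
  exact elem_mem_degenerate_of_eq_smul m (j := j) (Finset.piecewise_eq_of_mem _ _ _ hj)

/-- Since x − JPx is degenerate, so is its boundary, and P kills it: Pbx = PbJPx = PJbPx = bPx. -/
theorem chainsMap_proj_boundary [Module A M] [Module Aᵐᵒᵖ M] [IsScalarTower k A M]
    [IsScalarTower k Aᵐᵒᵖ M] (n : ℕ) (x : Chains k A M (n + 1)) :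
    chainsMap M (augmentationProj ε) n (boundary (NonUnitalAlgHom.id k A) M n x) =
      boundary (NonUnitalSubalgebraClass.subtype (augmentationIdeal ε)) M n
        (chainsMap M (augmentationProj ε) (n + 1) x) := by
  have h := chainsMap_proj_eq_zero ε
    (boundary_mem_degenerate (sub_chainsMap_mem_degenerate ε x))
  rw [map_sub, map_sub, sub_eq_zero] at h
  rw [h, ← chainsMap_boundary, chainsMap_proj_incl]

end Augmentation

end Hochschild

/-! ### Subcomplexes -/

section Subcomplexes

theorem Hochschild.complex_d {k B A : Type*} [CommRing k] [NonUnitalRing B] [Module k B]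
    [IsScalarTower k B B] [SMulCommClass k B B] [Ring A] [Algebra k A] (ι : B →ₙₐ[k] A) (M : Type*)
    [AddCommGroup M] [Module k M] [Module A M] [Module Aᵐᵒᵖ M] [IsScalarTower k A M]
    [IsScalarTower k Aᵐᵒᵖ M] [SMulCommClass A Aᵐᵒᵖ M] (n : ℕ) :
    (complex ι M).d (n + 1) n = ModuleCat.ofHom (boundary ι M n) :=
  ChainComplex.of_d (fun n => ModuleCat.of k (Chains k B M n))
    (fun n => ModuleCat.ofHom (boundary ι M n)) n

theorem Hochschild.isSubcomplex {k B A : Type*} [CommRing k] [NonUnitalRing B] [Module k B]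
    [IsScalarTower k B B] [SMulCommClass k B B] [Ring A] [Algebra k A] (ι : B →ₙₐ[k] A) (M : Type*)
    [AddCommGroup M] [Module k M] [Module A M] [Module Aᵐᵒᵖ M] [IsScalarTower k A M]
    [IsScalarTower k Aᵐᵒᵖ M] [SMulCommClass A Aᵐᵒᵖ M] (S : ∀ n, Submodule k (Chains k B M n))
    (h : ∀ n, ∀ x ∈ S (n + 1), boundary ι M n x ∈ S n) : IsSubcomplex (complex ι M) S := by
  intro i j x hx
  by_cases hij : i = j + 1
  · subst hij
    rw [complex_d]
    exact h j x hx
  · rw [(complex ι M).shape i j fun h' => hij h'.symm]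
    exact (S j).zero_mem

variable {k : Type*} [CommRing k] {K L : ChainComplex (ModuleCat k) ℕ}

/-- The chain map between subcomplexes induced by degreewise linear maps. -/
noncomputable def IsSubcomplex.map {S : ∀ n, Submodule k (K.X n)} {T : ∀ n, Submodule k (L.X n)}
    (hS : IsSubcomplex K S) (hT : IsSubcomplex L T) (f : ∀ n, K.X n →ₗ[k] L.X n)
    (hf : ∀ n, ∀ x ∈ S n, f n x ∈ T n)
    (hd : ∀ n, ∀ x ∈ S (n + 1), f n ((K.d (n + 1) n).hom x) = (L.d (n + 1) n).hom (f (n + 1) x)) :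
    hS.complex ⟶ hT.complex where
  f n := ModuleCat.ofHom ((f n).restrict (hf n))
  comm' i j hij := by
    obtain rfl : j + 1 = i := hij
    refine ModuleCat.hom_ext <| LinearMap.ext fun (x : S (j + 1)) => Subtype.ext ?_
    exact (hd j x x.2).symm

/-- A subcomplex `S` of `K` splits as `R ⊕ T` if a subcomplex `R` of `L` is a retract of `S` and
`T` is the complementary subcomplex. -/
theorem IsSubcomplex.nonempty_iso_biprod {S T : ∀ n, Submodule k (K.X n)}
    {R : ∀ n, Submodule k (L.X n)} (hS : IsSubcomplex K S) (hR : IsSubcomplex L R)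
    (hT : IsSubcomplex K T) (J : ∀ n, L.X n →ₗ[k] K.X n) (P : ∀ n, K.X n →ₗ[k] L.X n)
    (hJd : ∀ n x, J n ((L.d (n + 1) n).hom x) = (K.d (n + 1) n).hom (J (n + 1) x))
    (hPd : ∀ n x, P n ((K.d (n + 1) n).hom x) = (L.d (n + 1) n).hom (P (n + 1) x))
    (hPJ : ∀ n x, P n (J n x) = x) (hJ : ∀ n, ∀ x ∈ R n, J n x ∈ S n)
    (hP : ∀ n, ∀ x ∈ S n, P n x ∈ R n) (hTS : ∀ n, T n ≤ S n)
    (hPT : ∀ n, ∀ x ∈ T n, P n x = 0) (hsub : ∀ n, ∀ x ∈ S n, x - J n (P n x) ∈ T n) :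
    Nonempty (hS.complex ≅ hR.complex ⊞ hT.complex) := by
  let j : hR.complex ⟶ hS.complex := hR.map hS J hJ fun n x _ => hJd n x
  let p : hS.complex ⟶ hR.complex := hS.map hR P hP fun n x _ => hPd n x
  let t : hT.complex ⟶ hS.complex := hT.map hS (fun _ => LinearMap.id) hTS fun _ _ _ => rfl
  -- The projection complementary to the idempotent JP; it fixes `T` because P vanishes there.
  let q : hS.complex ⟶ hT.complex := hS.map hT (fun n => LinearMap.id - J n ∘ₗ P n) hsub
    fun n x _ => by simp [hPd, hJd]
  have hjp : j ≫ p = 𝟙 _ := by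
    refine HomologicalComplex.hom_ext _ _ fun n => ModuleCat.hom_ext <|
      LinearMap.ext fun (x : R n) => Subtype.ext ?_
    exact hPJ n x
  have hjq : j ≫ q = 0 := by
    refine HomologicalComplex.hom_ext _ _ fun n => ModuleCat.hom_ext <|
      LinearMap.ext fun (x : R n) => Subtype.ext ?_
    change J n x - J n (P n (J n x)) = 0
    rw [hPJ, sub_self]
  have htp : t ≫ p = 0 := by
    refine HomologicalComplex.hom_ext _ _ fun n => ModuleCat.hom_ext <|
      LinearMap.ext fun (x : T n) => Subtype.ext ?_
    exact hPT n x x.2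
  have htq : t ≫ q = 𝟙 _ := by
    refine HomologicalComplex.hom_ext _ _ fun n => ModuleCat.hom_ext <|
      LinearMap.ext fun (x : T n) => Subtype.ext ?_
    change (x : K.X n) - J n (P n x) = x
    rw [hPT n x x.2, map_zero, sub_zero]
  have htotal : p ≫ j + q ≫ t = 𝟙 _ := by
    refine HomologicalComplex.hom_ext _ _ fun n => ModuleCat.hom_ext <|
      LinearMap.ext fun (x : S n) => Subtype.ext ?_
    change J n (P n x) + ((x : K.X n) - J n (P n x)) = x
    abel
  exact ⟨{
    hom := biprod.lift p q
    inv := biprod.desc j t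
    hom_inv_id := by rw [biprod.lift_desc, htotal]
    inv_hom_id := by
      refine biprod.hom_ext' _ _ (biprod.hom_ext _ _ ?_ ?_) (biprod.hom_ext _ _ ?_ ?_) <;>
        simp [hjp, hjq, htp, htq] }⟩

end Subcomplexes

/-! ### The splitting of the Eulerian parts -/

theorem mainTheorem6 {k : Type*} [CommRing k] [Algebra ℚ k]
    {A : Type*} [CommRing A] [Algebra k A] (ε : A →ₐ[k] k)
    (M : Type*) [AddCommGroup M] [Module k M] [Module A M] [Module Aᵐᵒᵖ M]
    [IsScalarTower k A M] [IsScalarTower k Aᵐᵒᵖ M] [IsCentralScalar A M] [Module.Flat k M]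
    (w i : ℕ) (hi : 1 ≤ i) :
    ∃ (hCA : IsSubcomplex (Hochschild.algebraComplex k A M) fun n => Eulerian.part w i n ⊤)
      (hCI : IsSubcomplex (Hochschild.idealComplex M ε) fun n => Eulerian.part w i n ⊤)
      (hDA : IsSubcomplex (Hochschild.algebraComplex k A M) fun n =>
        Eulerian.part w i n (Hochschild.degenerate k A M n)),
      Nonempty (hCA.complex ≅ hCI.complex ⊞ hDA.complex) := by
  have hCA : IsSubcomplex (Hochschild.algebraComplex k A M) fun n => Eulerian.part w i n ⊤ := by
    refine Hochschild.isSubcomplex _ M _ ?_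
    rintro n _ ⟨x, -, rfl⟩
    exact ⟨_, trivial, (Hochschild.boundary_action _ M mul_comm w i n x).symm⟩
  have hCI : IsSubcomplex (Hochschild.idealComplex M ε) fun n => Eulerian.part w i n ⊤ := by
    refine Hochschild.isSubcomplex _ M _ ?_
    rintro n _ ⟨x, -, rfl⟩
    exact ⟨_, trivial, (Hochschild.boundary_action _ M
      (fun x y => Subtype.ext (mul_comm (x : A) y)) w i n x).symm⟩
  have hDA : IsSubcomplex (Hochschild.algebraComplex k A M) fun n =>
      Eulerian.part w i n (Hochschild.degenerate k A M n) := by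
    refine Hochschild.isSubcomplex _ M _ ?_
    rintro n _ ⟨x, hx, rfl⟩
    exact ⟨_, Hochschild.boundary_mem_degenerate hx,
      (Hochschild.boundary_action _ M mul_comm w i n x).symm⟩
  refine ⟨hCA, hCI, hDA, hCA.nonempty_iso_biprod hCI hDA
    (fun n => Hochschild.chainsMap M (Hochschild.augmentationIncl ε) n)
    (fun n => Hochschild.chainsMap M (Hochschild.augmentationProj ε) n)
    ?_ ?_ ?_ ?_ ?_ ?_ ?_ ?_⟩
  · intro n x
    rw [Hochschild.complex_d, Hochschild.complex_d]
    exact Hochschild.chainsMap_boundary M _ n x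
  · intro n x
    rw [Hochschild.complex_d, Hochschild.complex_d]
    exact Hochschild.chainsMap_proj_boundary ε n x
  · exact fun n x => Hochschild.chainsMap_proj_incl ε x
  · rintro n _ ⟨x, -, rfl⟩
    exact ⟨_, trivial, (Hochschild.chainsMap_action M _ _ x).symm⟩
  · rintro n _ ⟨x, -, rfl⟩
    exact ⟨_, trivial, (Hochschild.chainsMap_action M _ _ x).symm⟩
  · exact fun n => Submodule.map_mono le_top
  · rintro n _ ⟨x, hx, rfl⟩
    exact Hochschild.chainsMap_proj_eq_zero ε (Hochschild.action_mem_degenerate _ hx)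
  -- J and P commute with e, so ex − JPex = e(x − JPx) is the image under e of a degenerate chain.
  · rintro n _ ⟨x, -, rfl⟩
    refine ⟨_, Hochschild.sub_chainsMap_mem_degenerate ε x, ?_⟩
    rw [map_sub, ← Hochschild.chainsMap_action, ← Hochschild.chainsMap_action]
    rfl
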